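/- For a Tychonoff space $X$ let $C_p(X)$ be the real vector space of all continuous functions $X\to\mathbb{R}$ with the topology of pointwise convergence. A *Cook continuum* is a metrizable continuum (compact connected space) $M$ with more than one point such that, for every subcontinuum $C\subseteq M$, every continuous map $f\colon C\to M$ is either the identity on $C$ (i.e. the inclusion) or constant. A *rigid Bernstein set* is a set $B=\{x_\alpha:\alpha<2^\omega\}\subseteq\mathbb{R}$ (with the subspace topology) obtained as follows: let $\{(C_\alpha,f_\alpha):\alpha<2^\omega\}$ be an enumeration of all pairs $(C,f)$, where $C\subseteq\mathbb{R}$ is homeomorphic to the Cantor set and $f\colon C\to\mathbb{R}$ is a continuous map whose range $f(C)$ is uncountable and disjoint from $C$; the points $x_\alpha\in C_\alpha$ are chosen so that, with $y_\alpha=f_\alpha(x_\alpha)$, all the points $x_0,y_0,\dots,x_\alpha,y_\alpha,\dots$ are distinct. If $X$ is a Cook continuum or a rigid Bernstein set, then there is no continuous linear surjection of $C_p(X)$ onto $C_p(X)\times C_p(X)$. -/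

import Mathlib

/-- `C_p(X)`: the real vector space of all continuous functions `X → ℝ`, as a linear subspace of
`X → ℝ`. Coerced to a type it carries the subspace topology of the product topology, i.e. the
topology of pointwise convergence. -/
abbrev Cp (X : Type*) [TopologicalSpace X] : Submodule ℝ (X → ℝ) :=
  continuousSubmodule X ℝ ℝ

/-- A Cook continuum: a nondegenerate metrizable continuum `M` such that every continuous map
from a subcontinuum `C ⊆ M` to `M` is either the identity (the inclusion) or constant. -/
structure IsCookContinuum (M : Type*) [TopologicalSpace M] : Prop where
  metrizable : TopologicalSpace.MetrizableSpace M
  compact : CompactSpace M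
  connected : ConnectedSpace M
  nontrivial : Nontrivial M
  rigid : ∀ C : Set M, IsClosed C → IsConnected C → ∀ f : C → M, Continuous f →
    (∀ z : C, f z = z) ∨ (∃ c : M, ∀ z : C, f z = c)

/-- A pair `(C, f)`, where `C` is a copy of the Cantor set `2^ω` in `ℝ` and `f : C → ℝ` is a
continuous map with uncountable range disjoint from `C`. -/
structure CantorPair where
  C : Set ℝ
  f : C → ℝ
  cantor : Nonempty (C ≃ₜ (ℕ → Bool))
  continuous_f : Continuous f
  uncountable_range : ¬ (Set.range f).Countable
  disjoint_range : Disjoint (Set.range f) C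

/-- A rigid Bernstein set: for some enumeration `p` of all Cantor pairs by the ordinals
`α < 2^ω`, it is the set `{x α : α < 2^ω}`, where `x α ∈ C_α`, `y α = f_α (x α)` and all the
points `x α`, `y β` are distinct. -/
def IsRigidBernsteinSet (B : Set ℝ) : Prop :=
  ∃ p : Set.Iio Cardinal.continuum.{0}.ord → CantorPair, Function.Surjective p ∧
    ∃ (x : ∀ α, (p α).C) (y : Set.Iio Cardinal.continuum.{0}.ord → ℝ),
      (∀ α, y α = (p α).f (x α)) ∧
      Function.Injective (fun α => (x α : ℝ)) ∧
      Function.Injective y ∧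
      (∀ α β, (x α : ℝ) ≠ y β) ∧
      B = Set.range (fun α => (x α : ℝ))

/-!
Every continuous linear operator `S : C_p(X) → C_p(X)` is given by a finite combination of point
evaluations at each `y : X` (`exists_represents`), and the support of this combination depends
lower semicontinuously on `y` (`Represents.isOpen_setOf_support_inter_nonempty`). Where the size of
the support is locally constant, its points are therefore continuous functions of `y` with values
in `X`, and rigidity of `X` leaves for them only the identity and maps with small range. So there
are infinitely many `y` whose supports, for both coordinates of an operator
`T : C_p(X) → C_p(X) × C_p(X)`, lie in `{y} ∪ F` with one finite set `F`. On `m` of these points,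
`f ↦ T f` has `2m` coordinates that factor through `m + |F|` values of `f`, so for large `m` it is
not onto (`not_infinite_of_surjective`).

For a Cook continuum, Baire's theorem gives an open set on which the size of the support is
constant, and each of the resulting functions is the identity or constant on a nondegenerate
subcontinuum of that set (`IsCookContinuum.exists_subcontinuum_support_subset`).

For a rigid Bernstein set `B ⊆ ℝ`, it suffices that only countably many points occur in supports off
the diagonal (`IsRigidBernsteinSet.countable_support_ne`): a fixed finite set `F` is then shared by
uncountably many `y`. Otherwise the pairs `(y, z)`, with `z` the only point of the support at `y`
in some open set away from `y`, give a graph with uncountable range; its closure contains that of an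
injection on a Cantor set (`exists_cantor_in_closure_of_injOn_fst_snd`). By the choice of `B`, that
graph has a point `(t, s)` with `t ∈ B` and `s ∉ B`, yet semicontinuity of the support at `t` forces
`s` to belong to it.
-/

open Set Filter Topology

/-! ### Supports of operators on `C_p(X)` -/

theorem exists_finsupp_eq_sum_eval {X : Type*} [TopologicalSpace X] (φ : Cp X →L[ℝ] ℝ) :
    ∃ c : X →₀ ℝ, ∀ f : Cp X, φ f = c.sum fun x a => a * (f : X → ℝ) x := by
  let ev : X → Cp X →ₗ[ℝ] ℝ := fun x => (LinearMap.proj x).comp (Cp X).subtype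
  have hnhds : φ ⁻¹' Metric.ball 0 1 ∈ 𝓝 (0 : Cp X) :=
    φ.continuous.continuousAt.preimage_mem_nhds (by
      rw [map_zero]
      exact Metric.ball_mem_nhds _ one_pos)
  rw [nhds_subtype_eq_comap, nhds_pi, mem_comap] at hnhds
  obtain ⟨u, hu, hsub⟩ := hnhds
  obtain ⟨I, hI, t, ht, htu⟩ := Filter.mem_pi.1 hu
  have : Finite I := hI
  have hker : ⨅ i : I, LinearMap.ker (ev i) ≤ LinearMap.ker (φ : Cp X →ₗ[ℝ] ℝ) := by
    intro f hf
    rw [Submodule.mem_iInf] at hf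
    by_contra hne
    have hne' : φ f ≠ 0 := hne
    -- Rescaling to `φ = 1` keeps the function zero on `I`, hence inside the neighbourhood.
    have hmem : (φ f)⁻¹ • f ∈ φ ⁻¹' Metric.ball 0 1 := by
      refine hsub (htu fun i hi => ?_)
      have h0 : (f : X → ℝ) i = 0 := hf ⟨i, hi⟩
      have : ((((φ f)⁻¹ • f : Cp X) : X → ℝ)) i = 0 := by simp [h0]
      rw [this]
      exact mem_of_mem_nhds (ht i)
    simp [hne'] at hmem
  have hspan : (φ : Cp X →ₗ[ℝ] ℝ) ∈ Submodule.span ℝ (range ev) :=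
    Submodule.span_mono (by rintro _ ⟨i, rfl⟩; exact ⟨i, rfl⟩) (mem_span_of_iInf_ker_le_ker hker)
  obtain ⟨c, hc⟩ := Finsupp.mem_span_range_iff_exists_finsupp.1 hspan
  refine ⟨c, fun f => ?_⟩
  have := LinearMap.congr_fun hc f
  simp only [Finsupp.sum, LinearMap.sum_apply] at this ⊢
  exact this.symm

/-- The coefficients `c y` represent the operator `S` when `c y`, read as a finite combination of
point evaluations, is the functional `f ↦ S f y`. -/
def Represents {X : Type*} [TopologicalSpace X] (S : Cp X →L[ℝ] Cp X) (c : X → X →₀ ℝ) : Prop :=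
  ∀ (f : Cp X) (y : X), (S f : X → ℝ) y = (c y).sum fun x a => a * (f : X → ℝ) x

theorem exists_represents {X : Type*} [TopologicalSpace X] (S : Cp X →L[ℝ] Cp X) :
    ∃ c, Represents S c := by
  have h : ∀ y : X, ∃ c : X →₀ ℝ, ∀ f : Cp X,
      (S f : X → ℝ) y = c.sum fun x a => a * (f : X → ℝ) x := fun y =>
    exists_finsupp_eq_sum_eval
      (((ContinuousLinearMap.proj (R := ℝ) (φ := fun _ : X => ℝ) y).comp (Cp X).subtypeL).comp S)
  choose c hc using h
  exact ⟨c, fun f y => hc y f⟩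

theorem exists_mem_Cp_eq_one {X : Type*} [TopologicalSpace X] [T4Space X] {x : X} {O : Set X}
    (hO : IsOpen O) (hx : x ∈ O) :
    ∃ f : Cp X, (f : X → ℝ) x = 1 ∧ ∀ z, z ∉ O → (f : X → ℝ) z = 0 := by
  obtain ⟨f, h0, h1, -⟩ := exists_continuous_zero_one_of_isClosed hO.isClosed_compl
    (isClosed_singleton (x := x)) (by simpa using hx)
  exact ⟨⟨f, f.continuous⟩, h1 rfl, fun z hz => h0 hz⟩

/-- Lower semicontinuity of the support: a point of the support in `O` is detected by a function
vanishing off `O` and at the other points of the support. -/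
theorem Represents.isOpen_setOf_support_inter_nonempty {X : Type*} [TopologicalSpace X] [T4Space X]
    {S : Cp X →L[ℝ] Cp X} {c : X → X →₀ ℝ} (hc : Represents S c) {O : Set X} (hO : IsOpen O) :
    IsOpen {y | ∃ x ∈ (c y).support, x ∈ O} := by
  classical
  rw [isOpen_iff_mem_nhds]
  rintro y ⟨x, hx, hxO⟩
  obtain ⟨f, hf1, hf0⟩ := exists_mem_Cp_eq_one (x := x)
    (hO.inter ((c y).support.erase x).finite_toSet.isClosed.isOpen_compl) ⟨hxO, by simp⟩
  have hval : (S f : X → ℝ) y = c y x := by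
    rw [hc f y, Finsupp.sum, Finset.sum_eq_single x]
    · rw [hf1, mul_one]
    · intro z hz hzx
      rw [hf0 z (fun h => h.2 (by simpa [hzx] using hz)), mul_zero]
    · exact fun h => absurd hx h
  have hne : (S f : X → ℝ) y ≠ 0 := by rw [hval]; simpa using hx
  have hcont : Continuous (S f : X → ℝ) := (S f).2
  filter_upwards [hcont.continuousAt.eventually_ne hne] with y' hy'
  by_contra hno
  refine hy' ?_
  rw [hc f y']
  refine Finset.sum_eq_zero fun z hz => ?_
  have : z ∉ O := fun h => hno ⟨z, hz, h⟩
  simp [hf0 z (fun h => this h.1)]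

/-- If two operators are the coordinates of a surjection onto `C_p(X) × C_p(X)`, the functionals
at `y` cannot both be supported in `{y} ∪ F` for infinitely many `y`: on `m` such points the
surjection onto `ℝᵐ × ℝᵐ` would factor through the values of `f` at `m + |F|` points. -/
theorem not_infinite_of_surjective {X : Type*} [TopologicalSpace X] [T4Space X]
    {T : Cp X →L[ℝ] Cp X × Cp X} (hT : Function.Surjective T) {c₁ c₂ : X → X →₀ ℝ}
    (h₁ : Represents ((ContinuousLinearMap.fst ℝ _ _).comp T) c₁)
    (h₂ : Represents ((ContinuousLinearMap.snd ℝ _ _).comp T) c₂) {Y F : Set X} (hF : F.Finite)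
    (hY₁ : ∀ y ∈ Y, ∀ x ∈ (c₁ y).support, x = y ∨ x ∈ F)
    (hY₂ : ∀ y ∈ Y, ∀ x ∈ (c₂ y).support, x = y ∨ x ∈ F) : ¬ Y.Infinite := by
  classical
  intro hinf
  lift F to Finset X using hF
  obtain ⟨Y', hY'Y, hcard⟩ := hinf.exists_subset_card_eq (F.card + 1)
  let E : Finset X := Y' ∪ F
  let ev (c : X → X →₀ ℝ) : (E → ℝ) →ₗ[ℝ] (Y' → ℝ) :=
    LinearMap.pi fun y => ∑ x : E, c y x • LinearMap.proj x
  have hev : ∀ {S : Cp X →L[ℝ] Cp X} {c : X → X →₀ ℝ}, Represents S c →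
      (∀ y ∈ Y, ∀ x ∈ (c y).support, x = y ∨ x ∈ (F : Set X)) → ∀ (f : Cp X) (y : Y'),
      ev c (fun x => (f : X → ℝ) x) y = (S f : X → ℝ) y := by
    intro S c hc hsupp f y
    rw [hc f y]
    have hsub : (c y).support ⊆ E := by
      intro x hx
      rcases hsupp y (hY'Y y.2) x hx with h | h
      · exact Finset.mem_union_left _ (h ▸ y.2)
      · exact Finset.mem_union_right _ h
    rw [Finsupp.sum_of_support_subset _ hsub _ (by simp), ← Finset.sum_coe_sort E]
    simp [ev]
  have hsurj : Function.Surjective ((ev c₁).prod (ev c₂)) := by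
    -- Continuous functions take arbitrary values on the finite set `Y'`.
    have hint : ∀ w : Y' → ℝ, ∃ g : Cp X, ∀ y : Y', (g : X → ℝ) y = w y := by
      intro w
      obtain ⟨g, hg⟩ := ContinuousMap.exists_restrict_eq
        (Y'.finite_toSet.isClosed : IsClosed (Y' : Set X))
        (⟨w, continuous_of_discreteTopology⟩ : C((Y' : Set X), ℝ))
      exact ⟨⟨g, g.continuous⟩, fun y => DFunLike.congr_fun hg y⟩
    rintro ⟨w₁, w₂⟩
    obtain ⟨g₁, hg₁⟩ := hint w₁
    obtain ⟨g₂, hg₂⟩ := hint w₂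
    obtain ⟨f, hf⟩ := hT (g₁, g₂)
    refine ⟨fun x => (f : X → ℝ) x, Prod.ext (funext fun y => ?_) (funext fun y => ?_)⟩
    · refine (hev h₁ hY₁ f y).trans ?_
      simp [hf, hg₁]
    · refine (hev h₂ hY₂ f y).trans ?_
      simp [hf, hg₂]
  have hle := LinearMap.finrank_le_finrank_of_surjective hsurj
  simp only [Module.finrank_prod, Module.finrank_fintype_fun_eq_card, Fintype.card_coe] at hle
  have := Finset.card_union_le Y' F
  simp only [E] at hle
  omega

/-! ### Cook continua -/

/-- A weak form of boundary bumping: subcontinua are found in every neighbourhood of a point of a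
nondegenerate continuum. -/
theorem exists_isConnected_nontrivial_subset {M : Type*} [TopologicalSpace M] [CompactSpace M]
    [T2Space M] {K W : Set M} (hK : IsClosed K) (hKc : IsConnected K) (hKn : K.Nontrivial)
    (hW : IsOpen W) {y : M} (hyK : y ∈ K) (hyW : y ∈ W) :
    ∃ D ⊆ K ∩ W, IsClosed D ∧ IsConnected D ∧ D.Nontrivial := by
  obtain ⟨z, hzK, hzy⟩ := hKn.exists_ne y
  obtain ⟨N, hN, hNc, hNW⟩ := exists_mem_nhds_isClosed_subset
    ((hW.sdiff (isClosed_singleton (x := z))).mem_nhds ⟨hyW, fun h => hzy h.symm⟩)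
  have hP : IsClosed (K ∩ N) := hK.inter hNc
  have : CompactSpace ↥(K ∩ N) := isCompact_iff_compactSpace.1 hP.isCompact
  let x : ↥(K ∩ N) := ⟨y, hyK, mem_of_mem_nhds hN⟩
  refine ⟨Subtype.val '' connectedComponent x, ?_,
    hP.isClosedEmbedding_subtypeVal.isClosedMap _ isClosed_connectedComponent,
    isConnected_connectedComponent.image _ continuous_subtype_val.continuousOn, ?_⟩
  · rintro _ ⟨p, -, rfl⟩
    exact ⟨p.2.1, (hNW p.2.2).1⟩
  by_contra hnot
  have hsub : (connectedComponent x).Subsingleton :=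
    Set.not_nontrivial_iff.1 fun h => hnot (h.image Subtype.val_injective)
  have : Nonempty { s : Set ↥(K ∩ N) // IsClopen s ∧ x ∈ s } := ⟨⟨univ, isClopen_univ, mem_univ x⟩⟩
  -- If the component is a point, a clopen set of `K ∩ N` lies in the interior of `N`,
  -- and it is then clopen in `K`.
  obtain ⟨⟨V, hV, hxV⟩, hVN⟩ := exists_subset_nhds_of_compactSpace
    (V := fun s : { s : Set ↥(K ∩ N) // IsClopen s ∧ x ∈ s } => (s : Set ↥(K ∩ N)))
    (U := Subtype.val ⁻¹' interior N)
    (by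
      rintro ⟨a, ha, hxa⟩ ⟨b, hb, hxb⟩
      exact ⟨⟨a ∩ b, ha.inter hb, hxa, hxb⟩, inter_subset_left, inter_subset_right⟩)
    (fun s => s.2.1.1)
    (by
      intro p hp
      rw [← connectedComponent_eq_iInter_isClopen] at hp
      rw [hsub hp mem_connectedComponent]
      exact (isOpen_interior.preimage continuous_subtype_val).mem_nhds
        (mem_interior_iff_mem_nhds.2 hN))
  obtain ⟨O, hO, hOV⟩ := isOpen_induced_iff.1 hV.2
  have hVc : IsClosed (Subtype.val '' V) := hP.isClosedEmbedding_subtypeVal.isClosedMap _ hV.1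
  have hyO : y ∈ O := by rw [← hOV] at hxV; exact hxV
  obtain ⟨w, hwK, ⟨hwO, hwN⟩, hwV⟩ := hKc.isPreconnected (O ∩ interior N) (Subtype.val '' V)ᶜ
    (hO.inter isOpen_interior) hVc.isOpen_compl
    (by
      intro w hw
      by_cases h : w ∈ Subtype.val '' V
      · obtain ⟨p, hp, rfl⟩ := h
        exact Or.inl ⟨by rw [← hOV] at hp; exact hp, hVN hp⟩
      · exact Or.inr h)
    ⟨y, hyK, hyO, mem_interior_iff_mem_nhds.2 hN⟩
    ⟨z, hzK, by
      rintro ⟨p, -, rfl⟩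
      exact (hNW p.2.2).2 rfl⟩
  exact hwV ⟨⟨w, hwK, interior_subset hwN⟩, by rw [← hOV]; exact hwO, rfl⟩

/-- If a finite set `t` meets each of the disjoint sets `U x`, `x ∈ s`, and has no more points
than `s`, then it has exactly one point in each of them and no others. -/
theorem Finset.card_le_and_unique_of_pairwiseDisjoint {α : Type*} {s t : Finset α} {U : α → Set α}
    (hU : (s : Set α).PairwiseDisjoint U) (h : ∀ x ∈ s, ∃ z ∈ t, z ∈ U x) :
    s.card ≤ t.card ∧ (t.card ≤ s.card → (∀ z ∈ t, ∃ x ∈ s, z ∈ U x) ∧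
      ∀ x ∈ s, ∀ z ∈ t, ∀ w ∈ t, z ∈ U x → w ∈ U x → z = w) := by
  choose! g hg hgU using h
  have hinj : ∀ x ∈ s, ∀ x' ∈ s, ∀ z, z ∈ U x → z ∈ U x' → x = x' := fun x hx x' hx' z hz hz' =>
    hU.elim_set hx hx' z hz hz'
  have hgi : Set.InjOn g s := fun x hx x' hx' he =>
    hinj x hx x' hx' (g x) (hgU x hx) (he ▸ hgU x' hx')
  refine ⟨Finset.card_le_card_of_injOn g hg hgi, fun hle => ?_⟩
  have hsurj : ∀ z ∈ t, ∃ x ∈ s, g x = z := by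
    intro z hz
    obtain ⟨x, hx, h⟩ := Finset.surjOn_of_injOn_of_card_le g hg hgi hle hz
    exact ⟨x, hx, h⟩
  refine ⟨fun z hz => ?_, fun x hx z hz w hw hzU hwU => ?_⟩
  · obtain ⟨x, hx, rfl⟩ := hsurj z hz
    exact ⟨x, hx, hgU x hx⟩
  · obtain ⟨a, ha, rfl⟩ := hsurj z hz
    obtain ⟨b, hb, rfl⟩ := hsurj w hw
    rw [hinj a ha x hx _ (hgU a ha) hzU, hinj b hb x hx _ (hgU b hb) hwU]

/-- Near `y`, supports meet each of suitable disjoint neighbourhoods of the points of the support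
at `y`. -/
theorem Represents.exists_pairwiseDisjoint_eventually {X : Type*} [TopologicalSpace X] [T4Space X]
    {S : Cp X →L[ℝ] Cp X} {c : X → X →₀ ℝ} (hc : Represents S c) (y : X) :
    ∃ U : X → Set X, (∀ x, IsOpen (U x)) ∧ ((c y).support : Set X).PairwiseDisjoint U ∧
      ∀ᶠ y' in 𝓝 y, ∀ x ∈ (c y).support, ∃ z ∈ (c y').support, z ∈ U x := by
  obtain ⟨U, hU, hd⟩ := (c y).support.finite_toSet.t2_separation
  refine ⟨U, fun x => (hU x).2, hd, ?_⟩
  rw [Filter.eventually_all_finset]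
  intro x hx
  exact (hc.isOpen_setOf_support_inter_nonempty (hU x).2).mem_nhds ⟨x, hx, (hU x).1⟩

/-- By Baire's theorem the size of the support is constant on a nonempty open subset of `K`; there
the support is the union of finitely many continuous functions, each of which is the identity or
constant on subcontinua. -/
theorem IsCookContinuum.exists_subcontinuum_support_subset {M : Type*} [TopologicalSpace M]
    (hM : IsCookContinuum M) [CompactSpace M] [T4Space M] {S : Cp M →L[ℝ] Cp M}
    {c : M → M →₀ ℝ} (hc : Represents S c) {K : Set M} (hK : IsClosed K) (hKc : IsConnected K)
    (hKn : K.Nontrivial) :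
    ∃ D ⊆ K, IsClosed D ∧ IsConnected D ∧ D.Nontrivial ∧
      ∃ F : Set M, F.Finite ∧ ∀ y ∈ D, ∀ x ∈ (c y).support, x = y ∨ x ∈ F := by
  have : CompactSpace K := isCompact_iff_compactSpace.1 hK.isCompact
  have : Nonempty K := hKc.nonempty.to_subtype
  have hclosed : ∀ n, IsClosed {y : K | (c y).support.card ≤ n} := by
    intro n
    rw [← isOpen_compl_iff, isOpen_iff_mem_nhds]
    intro y hy
    obtain ⟨U, -, hd, hev⟩ := hc.exists_pairwiseDisjoint_eventually (y : M)
    filter_upwards [continuous_subtype_val.continuousAt.eventually hev] with y' hy' hle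
    exact hy ((Finset.card_le_and_unique_of_pairwiseDisjoint hd hy').1.trans hle)
  obtain ⟨n, hn⟩ := nonempty_interior_of_iUnion_of_closed hclosed
    (eq_univ_of_forall fun y => mem_iUnion.2 ⟨_, le_refl (c y).support.card⟩)
  obtain ⟨G, hGo, hGne, hGn⟩ : ∃ G : Set K, IsOpen G ∧ G.Nonempty ∧
      ∀ y ∈ G, (c y).support.card ≤ n :=
    ⟨_, isOpen_interior, hn, fun y hy => interior_subset (s := {y : K | (c y).support.card ≤ n}) hy⟩
  -- A point of `G` at which the support is largest.
  obtain ⟨y₀, hy₀G, hmax⟩ : ∃ y₀ ∈ G, ∀ y ∈ G, (c y).support.card ≤ (c y₀).support.card := by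
    have hb : BddAbove ((fun y : K => (c y).support.card) '' G) :=
      ⟨n, by rintro _ ⟨y, hy, rfl⟩; exact hGn y hy⟩
    obtain ⟨y₀, hy₀, h⟩ := Nat.sSup_mem (hGne.image _) hb
    exact ⟨y₀, hy₀, fun y hy => (le_csSup hb (mem_image_of_mem _ hy)).trans h.ge⟩
  obtain ⟨U, hU, hd, hev⟩ := hc.exists_pairwiseDisjoint_eventually (y₀ : M)
  obtain ⟨W₁, hW₁, hW₁o, hy₁⟩ := eventually_nhds_iff.1 hev
  obtain ⟨W₂, hW₂, hW₂G⟩ := isOpen_induced_iff.1 hGo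
  obtain ⟨D, hDK, hD, hDc, hDn⟩ := exists_isConnected_nontrivial_subset hK hKc hKn
    (hW₁o.inter hW₂) y₀.2 ⟨hy₁, by rw [← hW₂G] at hy₀G; exact hy₀G⟩
  have hmeet : ∀ y ∈ D, ∀ x ∈ (c y₀).support, ∃ z ∈ (c y).support, z ∈ U x := fun y hy =>
    hW₁ y (hDK hy).2.1
  have huniq : ∀ y ∈ D, (∀ z ∈ (c y).support, ∃ x ∈ (c y₀).support, z ∈ U x) ∧
      ∀ x ∈ (c y₀).support, ∀ z ∈ (c y).support, ∀ w ∈ (c y).support,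
        z ∈ U x → w ∈ U x → z = w := by
    intro y hy
    refine (Finset.card_le_and_unique_of_pairwiseDisjoint hd (hmeet y hy)).2 ?_
    refine hmax ⟨y, (hDK hy).1⟩ ?_
    rw [← hW₂G]
    exact (hDK hy).2.2
  -- The constants all occur in the support at any one point `d` of `D`.
  obtain ⟨d, hdD⟩ := hDc.nonempty
  refine ⟨D, hDK.trans inter_subset_left, hD, hDc, hDn, (c d).support,
    (c d).support.finite_toSet, fun y hy z hz => ?_⟩
  obtain ⟨x, hx, hzx⟩ := (huniq y hy).1 z hz
  choose h hh hhU using fun y : D => hmeet y y.2 x hx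
  have hcont : Continuous h := by
    refine continuous_iff_continuousAt.2 fun a => ?_
    rw [ContinuousAt, tendsto_def]
    intro V hV
    obtain ⟨V', hV'V, hV'o, haV'⟩ := mem_nhds_iff.1 hV
    have hopen := (hc.isOpen_setOf_support_inter_nonempty (hV'o.inter (hU x))).preimage
      (continuous_subtype_val : Continuous (Subtype.val : D → M))
    filter_upwards [hopen.mem_nhds ⟨h a, hh a, haV', hhU a⟩] with b hb
    obtain ⟨w, hw, hwV, hwU⟩ := hb
    rw [mem_preimage, (huniq b b.2).2 x hx _ (hh b) w hw (hhU b) hwU]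
    exact hV'V hwV
  have hzh : z = h ⟨y, hy⟩ := (huniq y hy).2 x hx z hz _ (hh _) hzx (hhU _)
  rcases hM.rigid D hD hDc h hcont with hid | ⟨a, ha⟩
  · exact Or.inl (hzh.trans (hid _))
  · refine Or.inr ?_
    rw [hzh, ha, ← ha ⟨d, hdD⟩]
    exact hh _

theorem IsCookContinuum.not_exists_surjective {M : Type*} [TopologicalSpace M]
    (hM : IsCookContinuum M) : ¬ ∃ T : Cp M →L[ℝ] (Cp M × Cp M), Function.Surjective T := by
  rintro ⟨T, hT⟩
  have := hM.metrizable
  have := hM.compact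
  have := hM.connected
  have := hM.nontrivial
  obtain ⟨c₁, h₁⟩ := exists_represents ((ContinuousLinearMap.fst ℝ _ _).comp T)
  obtain ⟨c₂, h₂⟩ := exists_represents ((ContinuousLinearMap.snd ℝ _ _).comp T)
  obtain ⟨K, -, hK, hKc, hKn, F₁, hF₁, hs₁⟩ := hM.exists_subcontinuum_support_subset h₁
    isClosed_univ isConnected_univ nontrivial_univ
  obtain ⟨D, hDK, hD, hDc, hDn, F₂, hF₂, hs₂⟩ := hM.exists_subcontinuum_support_subset h₂ hK hKc hKn
  exact not_infinite_of_surjective hT h₁ h₂ (hF₁.union hF₂)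
    (fun y hy x hx => (hs₁ y (hDK hy) x hx).imp_right Or.inl)
    (fun y hy x hx => (hs₂ y hy x hx).imp_right Or.inr)
    (hDc.isPreconnected.infinite_of_nontrivial hDn)

/-! ### Cantor sets in closures of partial injections -/

theorem Set.exists_ne_forall_nhds_not_countable {Z : Type*} [TopologicalSpace Z]
    [SecondCountableTopology Z] {W : Set Z} (hW : ¬ W.Countable) :
    ∃ p ∈ W, ∃ q ∈ W, p ≠ q ∧
      (∀ U ∈ 𝓝 p, ¬ (W ∩ U).Countable) ∧ ∀ U ∈ 𝓝 q, ¬ (W ∩ U).Countable := by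
  let b := TopologicalSpace.countableBasis Z
  let V : Set Z := ⋃ U ∈ {U ∈ b | (W ∩ U).Countable}, W ∩ U
  have hV : V.Countable :=
    ((TopologicalSpace.countable_countableBasis Z).mono fun U hU => hU.1).biUnion fun U hU => hU.2
  have hWV : ¬ (W \ V).Countable := fun h =>
    hW ((h.union hV).mono fun x hx => by
      by_cases hxV : x ∈ V
      · exact Or.inr hxV
      · exact Or.inl ⟨hx, hxV⟩)
  have hcond : ∀ p ∈ W \ V, ∀ U ∈ 𝓝 p, ¬ (W ∩ U).Countable := by
    intro p hp U hU hc
    obtain ⟨B, hB, hpB, hBU⟩ := (TopologicalSpace.isBasis_countableBasis Z).mem_nhds_iff.1 hU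
    exact hp.2 (mem_biUnion (⟨hB, hc.mono (inter_subset_inter_right _ hBU)⟩ :
      B ∈ {U ∈ b | (W ∩ U).Countable}) ⟨hp.1, hpB⟩)
  obtain ⟨p, hp, q, hq, hpq⟩ : (W \ V).Nontrivial := by
    by_contra h
    exact hWV (Set.not_nontrivial_iff.1 h).countable
  exact ⟨p, hp.1, q, hq.1, hpq, hcond p hp, hcond q hq⟩

section CantorScheme

variable {X Y : Type*} [MetricSpace X] [MetricSpace Y] [SecondCountableTopology X]
  [SecondCountableTopology Y]

/-- The splitting step of the Cantor scheme: both coordinates separate the two halves. -/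
theorem exists_split_of_injOn_fst_snd {W : Set (X × Y)} (hW : ¬ W.Countable)
    (h₁ : InjOn Prod.fst W) (h₂ : InjOn Prod.snd W) {ε : ℝ} (hε : 0 < ε) :
    ∃ W' : Bool → Set (X × Y), (∀ b, W' b ⊆ W ∧ ¬ (W' b).Countable ∧
      Metric.ediam (closure (W' b)) ≤ ENNReal.ofReal ε) ∧
      ∀ a b, a ≠ b → ∀ p ∈ closure (W' a), ∀ q ∈ closure (W' b), p.1 ≠ q.1 ∧ p.2 ≠ q.2 := by
  obtain ⟨p, hp, q, hq, hpq, hpc, hqc⟩ := Set.exists_ne_forall_nhds_not_countable hW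
  have hd₁ : 0 < dist p.1 q.1 := dist_pos.2 fun h => hpq (h₁ hp hq h)
  have hd₂ : 0 < dist p.2 q.2 := dist_pos.2 fun h => hpq (h₂ hp hq h)
  obtain ⟨r, hr, hrε, hr₁, hr₂⟩ : ∃ r : ℝ, 0 < r ∧ 2 * r ≤ ε ∧ 2 * r < dist p.1 q.1 ∧
      2 * r < dist p.2 q.2 := by
    refine ⟨min (ε / 2) (min (dist p.1 q.1 / 3) (dist p.2 q.2 / 3)), by positivity, ?_, ?_, ?_⟩
    · linarith [min_le_left (ε / 2) (min (dist p.1 q.1 / 3) (dist p.2 q.2 / 3))]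
    · linarith [(min_le_right (ε / 2) (min (dist p.1 q.1 / 3) (dist p.2 q.2 / 3))).trans
        (min_le_left _ _)]
    · linarith [(min_le_right (ε / 2) (min (dist p.1 q.1 / 3) (dist p.2 q.2 / 3))).trans
        (min_le_right _ _)]
  let pt : Bool → X × Y := fun b => cond b p q
  have hcl : ∀ b, ∀ z ∈ closure (W ∩ Metric.ball (pt b) r), dist z (pt b) ≤ r := fun b z hz =>
    Metric.closure_ball_subset_closedBall (closure_mono inter_subset_right hz)
  have hsep : ∀ z ∈ closure (W ∩ Metric.ball (pt true) r),
      ∀ w ∈ closure (W ∩ Metric.ball (pt false) r), z.1 ≠ w.1 ∧ z.2 ≠ w.2 := by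
    intro z hz w hw
    have hz' : dist z p ≤ r := hcl true z hz
    have hw' : dist w q ≤ r := hcl false w hw
    rw [Prod.dist_eq, max_le_iff] at hz' hw'
    constructor
    · intro h
      have := dist_triangle_left p.1 q.1 z.1
      rw [← h] at hw'
      linarith [hz'.1, hw'.1]
    · intro h
      have := dist_triangle_left p.2 q.2 z.2
      rw [← h] at hw'
      linarith [hz'.2, hw'.2]
  refine ⟨fun b => W ∩ Metric.ball (pt b) r, fun b => ⟨inter_subset_left, ?_, ?_⟩, ?_⟩
  · cases b
    · exact hqc _ (Metric.ball_mem_nhds _ hr)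
    · exact hpc _ (Metric.ball_mem_nhds _ hr)
  · refine Metric.ediam_le fun z hz w hw => ?_
    rw [edist_dist]
    refine ENNReal.ofReal_le_ofReal ?_
    linarith [dist_triangle_right z w (pt b), hcl b z hz, hcl b w hw]
  · intro a b hab z hz w hw
    cases a <;> cases b
    · exact absurd rfl hab
    · exact ⟨(hsep w hw z hz).1.symm, (hsep w hw z hz).2.symm⟩
    · exact hsep z hz w hw
    · exact absurd rfl hab

/-- A perfect set theorem for graphs of partial injections: an uncountable one has in its closure
a copy of the Cantor set that is again the graph of an injection. -/
theorem exists_cantor_in_closure_of_injOn_fst_snd [CompleteSpace X] [CompleteSpace Y]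
    {G : Set (X × Y)} (hG : ¬ G.Countable) (h₁ : InjOn Prod.fst G) (h₂ : InjOn Prod.snd G) :
    ∃ Φ : (ℕ → Bool) → X × Y, Continuous Φ ∧ (∀ σ, Φ σ ∈ closure G) ∧
      Function.Injective (fun σ => (Φ σ).1) ∧ Function.Injective (fun σ => (Φ σ).2) := by
  let N := {W : Set (X × Y) // W ⊆ G ∧ ¬ W.Countable}
  have hsplit : ∀ (W : N) (n : ℕ), ∃ W' : Bool → N, (∀ b, (W' b).1 ⊆ W.1 ∧
      Metric.ediam (closure (W' b).1) ≤ ENNReal.ofReal (1 / ((n : ℝ) + 1))) ∧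
      ∀ a b, a ≠ b → ∀ p ∈ closure (W' a).1, ∀ q ∈ closure (W' b).1,
        p.1 ≠ q.1 ∧ p.2 ≠ q.2 := by
    intro W n
    obtain ⟨W', h, hs⟩ := exists_split_of_injOn_fst_snd W.2.2 (h₁.mono W.2.1) (h₂.mono W.2.1)
      (Nat.one_div_pos_of_nat (n := n) : (0 : ℝ) < 1 / ((n : ℝ) + 1))
    exact ⟨fun b => ⟨W' b, (h b).1.trans W.2.1, (h b).2.1⟩, fun b => ⟨(h b).1, (h b).2.2⟩, hs⟩
  choose split hsub hsep using hsplit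
  let node : List Bool → N := fun l =>
    List.rec ⟨G, Subset.rfl, hG⟩ (fun a l W => split W l.length a) l
  let A : List Bool → Set (X × Y) := fun l => closure (node l).1
  have hanti : CantorScheme.ClosureAntitone A :=
    CantorScheme.Antitone.closureAntitone
      (fun l a => closure_mono (hsub (node l) l.length a).1) fun l => isClosed_closure
  have hdiam : CantorScheme.VanishingDiam A := by
    intro σ
    rw [← tendsto_add_atTop_iff_nat 1]
    have hlim : Tendsto (fun n : ℕ => ENNReal.ofReal (1 / ((n : ℝ) + 1))) atTop (𝓝 0) := by
      simpa using ENNReal.tendsto_ofReal tendsto_one_div_add_atTop_nhds_zero_nat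
    refine tendsto_of_tendsto_of_tendsto_of_le_of_le tendsto_const_nhds hlim
      (fun n => zero_le) fun n => ?_
    exact (hsub (node (PiNat.res σ n)) (PiNat.res σ n).length (σ n)).2.trans
      (le_of_eq (by rw [PiNat.res_length]))
  have hne : ∀ l, (A l).Nonempty := fun l =>
    (nonempty_iff_ne_empty.2 fun h => (node l).2.2 (by rw [h]; exact countable_empty)).closure
  have huniv := hanti.map_of_vanishingDiam hdiam hne
  let Φ : (ℕ → Bool) → X × Y := fun σ => (CantorScheme.inducedMap A).2 ⟨σ, huniv ▸ mem_univ σ⟩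
  have hmem : ∀ σ n, Φ σ ∈ A (PiNat.res σ n) := fun σ n => CantorScheme.map_mem _ n
  have hne_of : ∀ σ τ, σ ≠ τ → (Φ σ).1 ≠ (Φ τ).1 ∧ (Φ σ).2 ≠ (Φ τ).2 := by
    intro σ τ hστ
    by_contra hnot
    refine hστ (PiNat.res_injective (funext fun n => ?_))
    induction n with
    | zero => simp
    | succ n ih =>
      rw [PiNat.res_succ, PiNat.res_succ, ih]
      congr 1
      by_contra hab
      refine hnot (hsep (node (PiNat.res τ n)) (PiNat.res τ n).length _ _ hab _ ?_ _ ?_)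
      · rw [← ih]; exact hmem σ (n + 1)
      · exact hmem τ (n + 1)
  refine ⟨Φ, hdiam.map_continuous.comp (by fun_prop), fun σ => hmem σ 0, fun σ τ h => ?_,
    fun σ τ h => ?_⟩
  · by_contra hne
    exact (hne_of σ τ hne).1 h
  · by_contra hne
    exact (hne_of σ τ hne).2 h

end CantorScheme

/-! ### Rigid Bernstein sets -/

theorem IsRigidBernsteinSet.exists_mem_apply_notMem {B : Set ℝ} (hB : IsRigidBernsteinSet B)
    (P : CantorPair) : ∃ x : P.C, (x : ℝ) ∈ B ∧ P.f x ∉ B := by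
  obtain ⟨p, hp, x, y, hy, -, -, hxy, rfl⟩ := hB
  obtain ⟨α, rfl⟩ := hp P
  refine ⟨x α, ⟨α, rfl⟩, ?_⟩
  rintro ⟨β, hβ⟩
  exact hxy β α (hβ.trans (hy α).symm)

theorem IsRigidBernsteinSet.not_countable {B : Set ℝ} (hB : IsRigidBernsteinSet B) :
    ¬ B.Countable := by
  obtain ⟨p, -, x, y, -, hx, -, -, rfl⟩ := hB
  intro h
  have hc : Countable (Set.Iio Cardinal.continuum.{0}.ord) := by
    have : Countable (range fun α => (x α : ℝ)) := h.to_subtype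
    exact Countable.of_equiv _ (Equiv.ofInjective _ hx).symm
  have hle := Cardinal.mk_le_aleph0_iff.2 hc
  rw [Cardinal.mk_Iio_ordinal, Cardinal.card_ord, Cardinal.lift_continuum] at hle
  exact absurd Cardinal.aleph0_lt_continuum (not_lt.2 hle)

/-- A set in the plane whose second coordinates are uncountable and whose coordinates range over
disjoint closed sets has a limit point that leaves the square of a rigid Bernstein set, provided
first coordinates determine second ones. -/
theorem IsRigidBernsteinSet.exists_mem_closure_fst_mem_snd_notMem {B : Set ℝ}
    (hB : IsRigidBernsteinSet B) {G : Set (ℝ × ℝ)} (hG : ¬ (Prod.snd '' G).Countable)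
    (hG₁ : InjOn Prod.fst G)
    (hdisj : Disjoint (closure (Prod.fst '' G)) (closure (Prod.snd '' G))) :
    ∃ q ∈ closure G, q.1 ∈ B ∧ q.2 ∉ B := by
  obtain ⟨G', hG'G, hG₂, himg⟩ := Set.SurjOn.exists_subset_injOn_image_eq
    (Set.surjOn_image Prod.snd G)
  have hG' : ¬ G'.Countable := fun h => hG (himg ▸ h.image _)
  obtain ⟨Φ, hΦ, hΦG, hinj₁, hinj₂⟩ :=
    exists_cantor_in_closure_of_injOn_fst_snd hG' (hG₁.mono hG'G) hG₂
  have hΦG : ∀ σ, Φ σ ∈ closure G := fun σ => closure_mono hG'G (hΦG σ)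
  have he : Topology.IsEmbedding fun σ => (Φ σ).1 :=
    ((continuous_fst.comp hΦ).isClosedEmbedding hinj₁).isEmbedding
  let e : (ℕ → Bool) ≃ₜ range fun σ => (Φ σ).1 := he.toHomeomorph
  let P : CantorPair :=
    { C := range fun σ => (Φ σ).1
      f := fun t => (Φ (e.symm t)).2
      cantor := ⟨e.symm⟩
      continuous_f := continuous_snd.comp (hΦ.comp e.symm.continuous)
      uncountable_range := by
        intro h
        have hr : (range fun σ => (Φ σ).2).Countable :=
          h.mono (by rintro _ ⟨σ, rfl⟩; exact ⟨e σ, by simp⟩)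
        have : Countable (range fun σ => (Φ σ).2) := hr.to_subtype
        have : Countable (ℕ → Bool) := Countable.of_equiv _ (Equiv.ofInjective _ hinj₂).symm
        have hle := Cardinal.mk_le_aleph0_iff.2 this
        rw [← Cardinal.power_def, Cardinal.mk_bool, Cardinal.mk_nat] at hle
        exact absurd (Cardinal.cantor Cardinal.aleph0) (not_lt.2 hle)
      disjoint_range := by
        rw [Set.disjoint_left]
        rintro _ ⟨t, rfl⟩ ⟨τ, hτ⟩
        refine Set.disjoint_left.1 hdisj
          (image_closure_subset_closure_image continuous_fst ⟨_, hΦG τ, rfl⟩) ?_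
        simp only at hτ
        rw [hτ]
        exact image_closure_subset_closure_image continuous_snd ⟨_, hΦG _, rfl⟩ }
  obtain ⟨t, htB, hft⟩ := hB.exists_mem_apply_notMem P
  refine ⟨Φ (e.symm t), hΦG _, ?_, hft⟩
  have : (e (e.symm t) : ℝ) = t := by rw [e.apply_symm_apply]
  rw [← this] at htB
  exact htB

/-- Off the diagonal, the supports of the functionals `f ↦ S f y` use only countably many points.
Where the support at `y` has a single point `z` in an open set `O`, the pairs `(y, z)` form the
graph of a continuous function, which a rigid Bernstein set prevents from having an uncountable
range away from its domain. -/
theorem IsRigidBernsteinSet.countable_support_ne {B : Set ℝ} (hB : IsRigidBernsteinSet B)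
    {S : Cp B →L[ℝ] Cp B} {c : B → B →₀ ℝ} (hc : Represents S c) :
    {z : B | ∃ y, z ∈ (c y).support ∧ z ≠ y}.Countable := by
  let b := TopologicalSpace.countableBasis ℝ
  have hb : TopologicalSpace.IsTopologicalBasis b := TopologicalSpace.isBasis_countableBasis ℝ
  let G : Set ℝ × Set ℝ → Set (ℝ × ℝ) := fun J => {q | ∃ y z : B, q = (↑y, ↑z) ∧ ↑y ∈ J.1 ∧
    z ∈ (c y).support ∧ ↑z ∈ J.2 ∧ ∀ w ∈ (c y).support, ↑w ∈ J.2 → w = z}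
  -- The last condition on `(I, O)` passes to limits of points of `I`, where the support might
  -- otherwise have left `O`.
  let 𝒥 : Set (Set ℝ × Set ℝ) := {J | J ∈ b ×ˢ b ∧ Disjoint (closure J.1) (closure J.2) ∧
    ∀ y : B, ↑y ∈ closure J.1 → ∃ z ∈ (c y).support, ↑z ∈ J.2}
  have h𝒥 : 𝒥.Countable :=
    ((TopologicalSpace.countable_countableBasis ℝ).prod
      (TopologicalSpace.countable_countableBasis ℝ)).mono fun J hJ => hJ.1
  have hcover : {z : B | ∃ y, z ∈ (c y).support ∧ z ≠ y} ⊆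
      Subtype.val ⁻¹' ⋃ J ∈ 𝒥, Prod.snd '' G J := by
    rintro z ⟨y, hz, hzy⟩
    obtain ⟨u, hzu, hu, v, hyv, hv, huv⟩ :=
      exists_open_nhds_disjoint_closure (fun h => hzy (Subtype.ext h) : (z : ℝ) ≠ y)
    have hfin : (Subtype.val '' ((c y).support \ {z} : Set B)).Finite :=
      ((c y).support.finite_toSet.sdiff).image _
    obtain ⟨O, hO, hzO, hOu⟩ := hb.exists_subset_of_mem_open
      (⟨hzu, by rintro ⟨w, hw, hwz⟩; exact hw.2 (Subtype.ext hwz)⟩ :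
        (z : ℝ) ∈ u \ Subtype.val '' ((c y).support \ {z} : Set B)) (hu.sdiff hfin.isClosed)
    obtain ⟨V, hV, hVO⟩ := isOpen_induced_iff.1
      (hc.isOpen_setOf_support_inter_nonempty
        ((hb.isOpen hO).preimage (continuous_subtype_val : Continuous (Subtype.val : B → ℝ))))
    have hyV : (y : ℝ) ∈ V := by
      have : y ∈ Subtype.val ⁻¹' V := by rw [hVO]; exact ⟨z, hz, hzO⟩
      exact this
    obtain ⟨I, hI, hyI, hIV⟩ := hb.exists_closure_subset ((hV.inter hv).mem_nhds ⟨hyV, hyv⟩)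
    refine mem_biUnion (x := (I, O)) ⟨⟨hI, hO⟩, ?_, ?_⟩
      ⟨(y, z), ⟨y, z, rfl, hyI, hz, hzO, ?_⟩, rfl⟩
    · exact (huv.mono (closure_mono (hOu.trans sdiff_subset))
        ((hIV.trans inter_subset_right).trans subset_closure)).symm
    · intro y' hy'
      have : y' ∈ Subtype.val ⁻¹' V := (hIV hy').1
      rw [hVO] at this
      exact this
    · intro w hw hwO
      by_contra hwz
      exact (hOu hwO).2 ⟨w, ⟨hw, hwz⟩, rfl⟩
  refine Countable.mono hcover (Countable.preimage_of_injOn ?_ Subtype.val_injective.injOn)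
  refine h𝒥.biUnion ?_
  rintro ⟨I, O⟩ ⟨⟨-, hO⟩, hdisj, hmeet⟩
  by_contra hunc
  have hGI : Prod.fst '' G (I, O) ⊆ I := by
    rintro _ ⟨_, ⟨y, z, rfl, hy, -⟩, rfl⟩
    exact hy
  have hGO : Prod.snd '' G (I, O) ⊆ O := by
    rintro _ ⟨_, ⟨y, z, rfl, -, -, hz, -⟩, rfl⟩
    exact hz
  have hG₁ : InjOn Prod.fst (G (I, O)) := by
    rintro _ ⟨y, z, rfl, -, -, -, huniq⟩ _ ⟨y', z', rfl, -, hz', hzO', -⟩ h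
    obtain rfl : y = y' := Subtype.ext h
    rw [huniq z' hz' hzO']
  obtain ⟨⟨t, s⟩, hts, htB, hsB⟩ := hB.exists_mem_closure_fst_mem_snd_notMem hunc hG₁
    (hdisj.mono (closure_mono hGI) (closure_mono hGO))
  have htI : t ∈ closure I :=
    closure_mono hGI (image_closure_subset_closure_image continuous_fst ⟨_, hts, rfl⟩)
  -- The limit `s` must be the point of the support at `t` in `O`.
  obtain ⟨z, hz, hzO⟩ := hmeet ⟨t, htB⟩ htI
  have hzs : (z : ℝ) ≠ s := fun h => hsB (h ▸ z.2)
  obtain ⟨u, v, hu, hv, hzu, hsv, huv⟩ := t2_separation hzs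
  obtain ⟨V, hV, hVO⟩ := isOpen_induced_iff.1
    (hc.isOpen_setOf_support_inter_nonempty (((hb.isOpen hO).inter hu).preimage
      (continuous_subtype_val : Continuous (Subtype.val : B → ℝ))))
  have htV : t ∈ V := by
    have : (⟨t, htB⟩ : B) ∈ Subtype.val ⁻¹' V := by rw [hVO]; exact ⟨z, hz, hzO, hzu⟩
    exact this
  obtain ⟨_, ⟨hyV, hzv⟩, y', z', rfl, -, -, -, huniq⟩ :=
    mem_closure_iff.1 hts (V ×ˢ v) (hV.prod hv) ⟨htV, hsv⟩
  have hy'V : y' ∈ Subtype.val ⁻¹' V := hyV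
  rw [hVO] at hy'V
  obtain ⟨w, hw, hwO, hwu⟩ := hy'V
  rw [huniq w hw hwO] at hwu
  exact Set.disjoint_left.1 huv hwu hzv

theorem IsRigidBernsteinSet.not_exists_surjective {B : Set ℝ} (hB : IsRigidBernsteinSet B) :
    ¬ ∃ T : Cp B →L[ℝ] (Cp B × Cp B), Function.Surjective T := by
  classical
  rintro ⟨T, hT⟩
  obtain ⟨c₁, h₁⟩ := exists_represents ((ContinuousLinearMap.fst ℝ _ _).comp T)
  obtain ⟨c₂, h₂⟩ := exists_represents ((ContinuousLinearMap.snd ℝ _ _).comp T)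
  let off : B → Finset B := fun y => ((c₁ y).support ∪ (c₂ y).support).erase y
  have hoff : (range off).Countable := by
    refine (countable_ofPred_finite_subset
      ((hB.countable_support_ne h₁).union (hB.countable_support_ne h₂))).preimage_of_injOn
      (f := fun s : Finset B => (s : Set B)) Finset.coe_injective.injOn |>.mono ?_
    rintro _ ⟨y, rfl⟩
    refine ⟨Finset.finite_toSet _, fun z hz => ?_⟩
    obtain ⟨hzy, hz⟩ := Finset.mem_erase.1 hz
    exact (Finset.mem_union.1 hz).imp (fun h => ⟨y, h, hzy⟩) fun h => ⟨y, h, hzy⟩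
  -- Countably many possibilities for the uncountably many points of `B`.
  obtain ⟨F, hF⟩ : ∃ F : Finset B, ¬ (off ⁻¹' {F}).Countable := by
    by_contra! hcount
    refine hB.not_countable (countable_coe_iff.1 (countable_univ_iff.1 ?_))
    refine (hoff.biUnion fun F _ => hcount F).mono fun y _ => ?_
    exact mem_biUnion (mem_range_self y) rfl
  have hsupp : ∀ y ∈ off ⁻¹' {F}, ∀ x ∈ (c₁ y).support ∪ (c₂ y).support,
      x = y ∨ x ∈ (F : Set B) := by
    rintro y rfl x hx
    exact or_iff_not_imp_left.2 fun hxy => Finset.mem_coe.2 (Finset.mem_erase.2 ⟨hxy, hx⟩)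
  exact not_infinite_of_surjective hT h₁ h₂ F.finite_toSet
    (fun y hy x hx => hsupp y hy x (Finset.mem_union_left _ hx))
    (fun y hy x hx => hsupp y hy x (Finset.mem_union_right _ hx))
    fun hfin => hF hfin.countable

theorem mainTheorem4 :
    (∀ (M : Type*) [TopologicalSpace M], IsCookContinuum M →
      ¬ ∃ T : Cp M →L[ℝ] (Cp M × Cp M), Function.Surjective T) ∧
    (∀ B : Set ℝ, IsRigidBernsteinSet B →
      ¬ ∃ T : Cp B →L[ℝ] (Cp B × Cp B), Function.Surjective T) :=
  ⟨fun _ _ hM => hM.not_exists_surjective, fun _ hB => hB.not_exists_surjective⟩
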